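/- The semi-random graph process on $[n]=\{1,\dots,n\}$, $n\ge 1$, starts from the empty graph $H_0$. In each round $t\ge 1$ a vertex $u_t$ is chosen uniformly at random from $[n]$, independently of the past; the player then selects a vertex $v_t\in[n]$, and the edge $u_tv_t$ is added to $H_{t-1}$ to form the multigraph $H_t$ (loops and parallel edges are allowed). A strategy $\mathcal S$ on $[n]$ specifies, for every $t$ and every $(u_1,v_1,\dots,u_{t-1},v_{t-1},u_t)$, a probability distribution on $[n]$ from which $v_t$ is drawn. For a finite simple graph $G$ let $\mathcal P_G$ be the property of containing a (not necessarily induced) subgraph isomorphic to $G$. For $0<q<1$ let $\tau_{\mathcal P_G}(\mathcal S,q,n)$ be the minimum $t\ge 0$ such that $\mathbb P[H_t\in\mathcal P_G]\ge q$ when the player follows $\mathcal S$ ($\infty$ if there is no such $t$), let $\tau_{\mathcal P_G}(q,n)=\inf_{\mathcal S}\tau_{\mathcal P_G}(\mathcal S,q,n)$, the infimum being over all strategies on $[n]$, and let $$\tau_{\mathcal P_G}=\lim_{q\to1^-}\ \limsup_{n\to\infty}\frac{\ln \tau_{\mathcal P_G}(q,n)}{\ln n}.$$ The degeneracy of $G$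 is the smallest integer $d\ge 0$ such that every non-empty subgraph of $G$ has minimum degree at most $d$. **Corollary.** Let $G$ be a fixed finite simple graph of degeneracy $d\ge 1$. Then the limit $\tau_{\mathcal P_G}$ exists and $$\tau_{\mathcal P_G}=\frac{d-1}{d}.$$ -/

import Mathlib

open Filter Topology
open scoped ENNReal

namespace SemiRandom

/-- `G` is `d`-degenerate: every (non-empty) subgraph of `G` has minimum degree at most `d`. -/
def IsDegenerate {V : Type*} (G : SimpleGraph V) (d : ℕ) : Prop :=
  ∀ G' : G.Subgraph, G'.verts.Nonempty → ∃ v ∈ G'.verts, (G'.neighborSet v).ncard ≤ d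

/-- The degeneracy of a finite graph: the smallest `d` for which it is `d`-degenerate. -/
noncomputable def degeneracy {V : Type*} (G : SimpleGraph V) : ℕ :=
  sInf {d : ℕ | IsDegenerate G d}

/-- A multigraph on the vertex set `[n]`, loops and parallel edges allowed, given by its
multiset of edges. -/
abbrev Multigraph (n : ℕ) : Type := Multiset (Sym2 (Fin n))

/-- The history of the process: the list of the pairs `(u_i, v_i)` (square, circle) of the rounds
played so far, the most recent round first. -/
abbrev History (n : ℕ) : Type := List (Fin n × Fin n)

/-- The multigraph formed by the edges `u_i v_i` of a history. -/
def History.graph {n : ℕ} (h : History n) : Multigraph n :=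
  (h.map fun p => s(p.1, p.2) : List (Sym2 (Fin n)))

/-- A strategy on `[n]`: given the history of the process and the presented vertex `u_t`, a
probability distribution on `[n]` from which `v_t` is chosen. The round number `t` is determined
by the length of the history. -/
abbrev Strategy (n : ℕ) : Type := History n → Fin n → PMF (Fin n)

/-- The law of the history after `t` rounds when the player follows the strategy `S`: in each round
`u` is uniform on `[n]`, independent of the past, and then `v` is drawn from `S h u`. -/
noncomputable def historyLaw {n : ℕ} [NeZero n] (S : Strategy n) : ℕ → PMF (History n)
  | 0 => PMF.pure []
  | t + 1 => (historyLaw S t).bind fun h =>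
      (PMF.uniformOfFintype (Fin n)).bind fun u => (S h u).map fun v => (u, v) :: h

/-- The law of the random multigraph `H_t` obtained by following `S` for `t` rounds. -/
noncomputable def graphLaw {n : ℕ} [NeZero n] (S : Strategy n) (t : ℕ) : PMF (Multigraph n) :=
  (historyLaw S t).map History.graph

/-- `ℙ[H_t ∈ P]` when the player follows `S`. -/
noncomputable def prob {n : ℕ} [NeZero n] (S : Strategy n) (t : ℕ) (P : Set (Multigraph n)) :
    ℝ≥0∞ :=
  (graphLaw S t).toOuterMeasure P

/-- `τ_P(S, q, n)`: the minimum `t ≥ 0` with `ℙ[H_t ∈ P] ≥ q`, and `∞` if there is no such `t`. -/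
noncomputable def strategyTime {n : ℕ} [NeZero n] (P : Set (Multigraph n)) (S : Strategy n)
    (q : ℝ) : ℕ∞ :=
  ⨅ (t : ℕ) (_ : ENNReal.ofReal q ≤ prob S t P), (t : ℕ∞)

/-- `τ_P(q, n)`: the infimum of `τ_P(S, q, n)` over all strategies `S` on `[n]`. -/
noncomputable def optimalTime {n : ℕ} [NeZero n] (P : Set (Multigraph n)) (q : ℝ) : ℕ∞ :=
  ⨅ S : Strategy n, strategyTime P S q

/-- `limsup_{n → ∞} ln τ_P(q, n) / ln n`, an extended real (with `ln 0 = -∞`, `ln ∞ = ∞`). The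
number of vertices is `n + 1`, which ranges over all positive integers. -/
noncomputable def exponentAt (P : ∀ n : ℕ, Set (Multigraph n)) (q : ℝ) : EReal :=
  limsup (fun n : ℕ =>
    ENNReal.log ((optimalTime (P (n + 1)) q : ℕ∞) : ℝ≥0∞) /
      ((Real.log ((n + 1 : ℕ) : ℝ) : ℝ) : EReal)) atTop

/-- The limit `τ_P = lim_{q → 1⁻} limsup_{n → ∞} ln τ_P(q, n) / ln n` exists and equals `τ`. -/
def HasThresholdExponent (P : ∀ n : ℕ, Set (Multigraph n)) (τ : EReal) : Prop :=
  Tendsto (exponentAt P) (𝓝[<] 1) (𝓝 τ)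

/-- The property `𝒫_G` of containing a subgraph isomorphic to the simple graph `G`. Loops and
multiplicities of edges play no role for it, so that it is a property of the simple graph
underlying the multigraph. -/
def containsCopy {V : Type*} (G : SimpleGraph V) (n : ℕ) : Set (Multigraph n) :=
  {H | G.IsContained (SimpleGraph.fromEdgeSet {e | e ∈ H})}

end SemiRandom

/-!
For every `q` in `(0, 1)` the optimal time is of order `n ^ ((d - 1) / d)`, from below and from
above, so that the exponent does not depend on `q`.

**Lower bound.** The rounds are read as arcs `u → v` from the presented vertex to the chosen one.
A vertex `x` is *hit* in a round if the presented vertex can be reached from `x` along at most `M`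
earlier arcs, where `M` is a constant. As long as no vertex has `d` hits, all out-degrees are below
`d`, hence at most `K = d ^ M` vertices can be reached from `x`, and `x` is hit with probability at
most `K / n` in a round, whatever the player does. Therefore some vertex has `d` hits after `t`
rounds with probability at most `n (t K / n) ^ d` (`toOuterMeasure_counter_le`). On the other hand,
in any digraph with ordered arcs there is a vertex whose degree is at most its number of hits
(`exists_degree_le_hits`). A graph of degeneracy `d` has a subgraph of minimum degree at least `d`,
and applying this to the arcs of a copy of that subgraph produces a vertex with `d` hits.

**Upper bound.** The player builds a copy vertex by vertex, in an order in which each vertex has at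
most `d` earlier neighbours. With `m` about `n ^ (1 / d)`, a new vertex is found in `d` stages: from
a pool of about `m ^ (d - i)` vertices joined to the first `i` targets, `m ^ (d - i - 1)` are joined
to the next target, which takes expected time at most `2 n / m` (`ReachableWithin.extend`). Expected
times are handled through the predicate `ReachableWithin`, defined by dynamic programming, for which
one stage is a backward induction; Markov's inequality turns them into success probabilities
(`exists_strategy_mul_le`).
-/

namespace SemiRandom

/-! ### Hits in a digraph with ordered arcs -/

section Combinatorics

variable {α : Type*} [DecidableEq α]

/-- The out-neighbours of `x` when a list of pairs is read as a list of arcs. -/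
def outNbrs (h : List (α × α)) (x : α) : Finset α :=
  ((h.filter fun p => p.1 = x).map Prod.snd).toFinset

/-- The set of vertices that can be reached from `v` along at most `M` arcs of `h`. -/
def outBall (h : List (α × α)) : ℕ → α → Finset α
  | 0, v => {v}
  | M + 1, v => (outBall h M v).biUnion fun x => insert x (outNbrs h x)

/-- The number of arcs of `h` (most recent first) whose tail, at the time when the arc was added,
could be reached from `v` along at most `M` arcs. -/
def hits (M : ℕ) : List (α × α) → α → ℕ
  | [], _ => 0
  | p :: h, v => hits M h v + if p.1 ∈ outBall h M v then 1 else 0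

/-- The out-ball of `v`, replaced by the empty set when it has more than `K` elements. -/
def cappedBall (M K : ℕ) (h : List (α × α)) (v : α) : Finset α :=
  if (outBall h M v).card ≤ K then outBall h M v else ∅

/-- The variant of `hits` in which only out-balls with at most `K` elements are taken into
account. -/
def cappedHits (M K : ℕ) : List (α × α) → α → ℕ
  | [], _ => 0
  | p :: h, v => cappedHits M K h v + if p.1 ∈ cappedBall M K h v then 1 else 0

@[simp]
lemma mem_outNbrs {h : List (α × α)} {x y : α} : y ∈ outNbrs h x ↔ (x, y) ∈ h := by
  simp only [outNbrs, List.mem_toFinset, List.mem_map, List.mem_filter, decide_eq_true_eq]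
  constructor
  · rintro ⟨⟨a, b⟩, ⟨hp, rfl⟩, rfl⟩
    exact hp
  · intro hp
    exact ⟨(x, y), ⟨hp, rfl⟩, rfl⟩

lemma mem_outBall_succ {h : List (α × α)} {M : ℕ} {v y : α} :
    y ∈ outBall h (M + 1) v ↔ ∃ x ∈ outBall h M v, y = x ∨ (x, y) ∈ h := by
  simp [outBall]

lemma outBall_subset_succ (h : List (α × α)) (M : ℕ) (v : α) :
    outBall h M v ⊆ outBall h (M + 1) v := fun y hy =>
  mem_outBall_succ.2 ⟨y, hy, Or.inl rfl⟩

lemma outBall_mono_radius (h : List (α × α)) (v : α) : Monotone fun M => outBall h M v :=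
  monotone_nat_of_le_succ fun M => outBall_subset_succ h M v

lemma self_mem_outBall (h : List (α × α)) (M : ℕ) (v : α) : v ∈ outBall h M v :=
  outBall_mono_radius h v (Nat.zero_le M) (by simp [outBall])

lemma outBall_mono_list {L h : List (α × α)} (hL : L ⊆ h) (M : ℕ) (v : α) :
    outBall L M v ⊆ outBall h M v := by
  induction M with
  | zero => exact subset_rfl
  | succ M ih =>
    intro y hy
    obtain ⟨x, hx, hxy⟩ := mem_outBall_succ.1 hy
    exact mem_outBall_succ.2 ⟨x, ih hx, hxy.imp id fun e => hL e⟩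

lemma outBall_trans {h : List (α × α)} {a b : ℕ} {v w y : α} (hw : w ∈ outBall h a v)
    (hy : y ∈ outBall h b w) : y ∈ outBall h (a + b) v := by
  induction b generalizing y with
  | zero =>
    have : y = w := by simpa [outBall] using hy
    exact this ▸ hw
  | succ b ih =>
    obtain ⟨x, hx, hxy⟩ := mem_outBall_succ.1 hy
    exact mem_outBall_succ.2 ⟨x, ih hx, hxy⟩

lemma card_outBall_le {h : List (α × α)} {d : ℕ} (hd : ∀ x, (outNbrs h x).card < d) (M : ℕ)
    (v : α) : (outBall h M v).card ≤ d ^ M := by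
  induction M with
  | zero => simp [outBall]
  | succ M ih =>
    rw [pow_succ]
    refine (Finset.card_biUnion_le_card_mul _ _ d fun x _ => ?_).trans (Nat.mul_le_mul_right d ih)
    exact (Finset.card_insert_le _ _).trans (hd x)

lemma card_outNbrs_le_hits (M : ℕ) (h : List (α × α)) (x : α) :
    (outNbrs h x).card ≤ hits M h x := by
  induction h with
  | nil => simp [outNbrs]
  | cons p h ih =>
    rw [hits]
    by_cases hp : p.1 = x
    · rw [hp, if_pos (self_mem_outBall h M x)]
      have : outNbrs (p :: h) x ⊆ insert p.2 (outNbrs h x) := by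
        intro y hy
        rcases List.mem_cons.1 (mem_outNbrs.1 hy) with e | e
        · simp [← e]
        · simp [e]
      exact (Finset.card_le_card this).trans ((Finset.card_insert_le _ _).trans (by omega))
    · have : outNbrs (p :: h) x ⊆ outNbrs h x := by
        intro y hy
        rcases List.mem_cons.1 (mem_outNbrs.1 hy) with e | e
        · exact absurd (by rw [← e]) hp
        · exact mem_outNbrs.2 e
      exact (Finset.card_le_card this).trans (by omega)

/-- As long as no vertex has `d` capped hits, every out-degree is below `d`, so that the out-balls
of radius `M` have at most `d ^ M` elements and the cap is never active. -/
lemma hits_eq_cappedHits {M d : ℕ} {h : List (α × α)}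
    (hd : ∀ v, cappedHits M (d ^ M) h v < d) (v : α) :
    hits M h v = cappedHits M (d ^ M) h v := by
  induction h generalizing v with
  | nil => rfl
  | cons p h ih =>
    have hd' : ∀ v, cappedHits M (d ^ M) h v < d := fun v =>
      lt_of_le_of_lt (by rw [cappedHits]; omega) (hd v)
    have hout : ∀ x, (outNbrs h x).card < d := fun x =>
      (card_outNbrs_le_hits M h x).trans_lt (ih hd' x ▸ hd' x)
    rw [hits, cappedHits, ih hd', cappedBall, if_pos (card_outBall_le hout M v)]

lemma hits_mono {L h : List (α × α)} (hL : L.Sublist h) (M : ℕ) (v : α) :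
    hits M L v ≤ hits M h v := by
  induction hL with
  | slnil => rfl
  | cons p _ ih => exact ih.trans (by rw [hits]; omega)
  | cons_cons p hs ih =>
    rw [hits, hits]
    refine Nat.add_le_add ih ?_
    split_ifs with h1 h2
    · rfl
    · exact absurd (outBall_mono_list hs.subset M v h1) h2
    · omega
    · rfl

/-- Every vertex `w` of a digraph with ordered arcs can be reached from a vertex whose degree is
at most its number of hits. When an arc `x → y` is added, only the vertex `y` gains degree without
necessarily being hit; but `y` can now be reached from whatever vertex served `x`, and that vertex
is hit by the new arc. -/
lemma exists_degree_le_hits (L : List (α × α)) {M : ℕ} (hM : 2 ^ L.length ≤ M) (w : α) :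
    ∃ v, w ∈ outBall L (2 ^ L.length - 1) v ∧
      L.countP (fun p => p.1 = v ∨ p.2 = v) ≤ hits M L v := by
  induction L generalizing w with
  | nil => exact ⟨w, self_mem_outBall _ _ _, by simp⟩
  | cons p L ih =>
    have hpos : 0 < 2 ^ L.length := by positivity
    have hlen : 2 ^ (p :: L).length = 2 * 2 ^ L.length := by rw [List.length_cons, pow_succ']
    rw [hlen] at hM ⊢
    have key : ∀ v y, y ∈ outBall L (2 ^ L.length - 1) v →
        y ∈ outBall (p :: L) (2 ^ L.length - 1) v := fun v y hy =>
      outBall_mono_list (List.subset_cons_self p L) _ v hy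
    -- a vertex serving the tail of the new arc is hit by it
    have hit : ∀ v, p.1 ∈ outBall L (2 ^ L.length - 1) v →
        L.countP (fun p => p.1 = v ∨ p.2 = v) ≤ hits M L v →
        (p :: L).countP (fun p => p.1 = v ∨ p.2 = v) ≤ hits M (p :: L) v := by
      intro v hv hle
      rw [hits, if_pos (outBall_mono_radius L v (by omega) hv), List.countP_cons]
      split_ifs <;> omega
    obtain ⟨v, hvw, hv⟩ := ih (by omega) w
    by_cases h1 : p.1 = v
    · exact ⟨v, outBall_mono_radius _ v (by omega) (key v w hvw),
        hit v (h1 ▸ self_mem_outBall _ _ _) hv⟩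
    · by_cases h2 : p.2 = v
      · obtain ⟨v', hvx, hv'⟩ := ih (by omega) p.1
        refine ⟨v', ?_, hit v' hvx hv'⟩
        have h3 : p.2 ∈ outBall (p :: L) (2 ^ L.length - 1 + 1) v' :=
          mem_outBall_succ.2 ⟨p.1, key v' _ hvx, Or.inr (by simp)⟩
        rw [h2] at h3
        exact outBall_mono_radius _ v' (by omega) (outBall_trans h3 (key v w hvw))
      · refine ⟨v, outBall_mono_radius _ v (by omega) (key v w hvw), ?_⟩
        rw [hits, List.countP_cons, if_neg (by simp [h1, h2])]
        omega

end Combinatorics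

/-! ### No strategy is fast -/

lemma toOuterMeasure_historyLaw_succ {n : ℕ} [NeZero n] (S : Strategy n) (t : ℕ)
    (E : Set (History n)) :
    (historyLaw S (t + 1)).toOuterMeasure E = ∑' h, historyLaw S t h *
      ∑ u, (n : ℝ≥0∞)⁻¹ * (S h u).toOuterMeasure {v | (u, v) :: h ∈ E} := by
  rw [historyLaw, PMF.toOuterMeasure_bind_apply]
  refine tsum_congr fun h => ?_
  rw [PMF.toOuterMeasure_bind_apply, tsum_fintype]
  congr 1
  refine Finset.sum_congr rfl fun u _ => ?_
  rw [PMF.toOuterMeasure_map_apply, PMF.uniformOfFintype_apply, Fintype.card_fin]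
  rfl

lemma toOuterMeasure_le_one {α : Type*} (p : PMF α) (s : Set α) : p.toOuterMeasure s ≤ 1 := by
  rw [PMF.toOuterMeasure_apply, ← p.tsum_coe]
  exact ENNReal.tsum_le_tsum fun x => Set.indicator_le_self _ _ x

lemma toOuterMeasure_eq_tsum_mul {α : Type*} (p : PMF α) (s : Set α) :
    p.toOuterMeasure s = ∑' x, p x * s.indicator 1 x := by
  rw [PMF.toOuterMeasure_apply]
  refine tsum_congr fun x => ?_
  by_cases hx : x ∈ s <;> simp [hx]

/-- A counter that grows by at most one per round, and only if the presented vertex lies in a set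
of at most `K` vertices fixed beforehand, reaches `k` within `t` rounds with probability at most
`(t K / n) ^ k`, whatever the player does. -/
lemma toOuterMeasure_counter_le {n : ℕ} [NeZero n] (S : Strategy n) {X : History n → ℕ}
    {D : History n → Finset (Fin n)} {K : ℕ} (h0 : X [] = 0)
    (hX : ∀ h p, X (p :: h) ≤ X h + if p.1 ∈ D h then 1 else 0) (hD : ∀ h, (D h).card ≤ K)
    (t k : ℕ) :
    (historyLaw S t).toOuterMeasure {h | k ≤ X h} ≤ ((t : ℝ≥0∞) * (K / n)) ^ k := by
  induction t generalizing k with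
  | zero =>
    rw [historyLaw, PMF.toOuterMeasure_pure_apply]
    rcases Nat.eq_zero_or_pos k with rfl | hk
    · simp
    · rw [if_neg (by simp [h0, hk.ne'])]
      exact zero_le
  | succ t ih =>
    rcases k with _ | k
    · simpa using toOuterMeasure_le_one _ _
    have hn : (n : ℝ≥0∞) ≠ 0 := by exact_mod_cast NeZero.ne n
    have step : ∀ h, (∑ u, (n : ℝ≥0∞)⁻¹ *
        (S h u).toOuterMeasure {v | (u, v) :: h ∈ {h | k + 1 ≤ X h}}) ≤
        {h | k + 1 ≤ X h}.indicator 1 h + (K / n) * {h | k ≤ X h}.indicator 1 h := by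
      intro h
      by_cases h1 : k + 1 ≤ X h
      · rw [Set.indicator_of_mem (by exact h1)]
        refine le_trans ?_ le_self_add
        calc _ ≤ ∑ _u : Fin n, (n : ℝ≥0∞)⁻¹ * 1 :=
              Finset.sum_le_sum fun u _ => mul_le_mul_right (toOuterMeasure_le_one _ _) _
          _ = 1 := by
              simp [ENNReal.mul_inv_cancel hn (ENNReal.natCast_ne_top n)]
      · have hzero : ∀ u, u ∉ D h ∨ ¬ k ≤ X h →
            (S h u).toOuterMeasure {v | (u, v) :: h ∈ {h | k + 1 ≤ X h}} = 0 := by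
          intro u hu
          convert MeasureTheory.measure_empty (μ := (S h u).toOuterMeasure)
          ext v
          simp only [Set.mem_ofPred_eq, Set.mem_empty_iff_false, iff_false]
          intro hv
          have := hX h (u, v)
          by_cases hd : u ∈ D h
          · simp only [hd, if_true] at this
            exact hu.elim (fun e => e hd) fun e => e (by omega)
          · simp only [hd, if_false] at this
            omega
        by_cases h2 : k ≤ X h
        · rw [Set.indicator_of_mem (show h ∈ {h | k ≤ X h} from h2)]
          refine le_trans ?_ le_add_self
          calc _ ≤ ∑ u : Fin n, if u ∈ D h then (n : ℝ≥0∞)⁻¹ else 0 := by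
                refine Finset.sum_le_sum fun u _ => ?_
                split_ifs with hu
                · exact (mul_le_mul_right (toOuterMeasure_le_one _ _) _).trans (mul_one _).le
                · rw [hzero u (Or.inl hu), mul_zero]
            _ = (D h).card * (n : ℝ≥0∞)⁻¹ := by simp
            _ ≤ _ := by
                rw [Pi.one_apply, mul_one, div_eq_mul_inv]
                exact mul_le_mul_left (by exact_mod_cast hD h) _
        · rw [Finset.sum_eq_zero fun u _ => by rw [hzero u (Or.inr h2), mul_zero]]
          exact zero_le
    rw [toOuterMeasure_historyLaw_succ]
    calc _ ≤ ∑' h, historyLaw S t h * ({h | k + 1 ≤ X h}.indicator 1 h +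
            (K / n) * {h | k ≤ X h}.indicator 1 h) :=
          ENNReal.tsum_le_tsum fun h => mul_le_mul_right (step h) _
      _ = (historyLaw S t).toOuterMeasure {h | k + 1 ≤ X h} +
            (K / n) * (historyLaw S t).toOuterMeasure {h | k ≤ X h} := by
          simp_rw [mul_add, ENNReal.tsum_add, toOuterMeasure_eq_tsum_mul, ← ENNReal.tsum_mul_left]
          congr 2
          ext h
          ring
      _ ≤ ((t : ℝ≥0∞) * (K / n)) ^ (k + 1) + (K / n) * ((t : ℝ≥0∞) * (K / n)) ^ k :=
          add_le_add (ih _) (mul_le_mul_right (ih _) _)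
      _ = (t : ℝ≥0∞) ^ k * (t + 1) * (K / n : ℝ≥0∞) ^ (k + 1) := by ring
      _ ≤ ((t : ℝ≥0∞) + 1) ^ k * (t + 1) * (K / n : ℝ≥0∞) ^ (k + 1) := by
          gcongr
          exact le_self_add
      _ = _ := by rw [Nat.cast_succ, mul_pow]; ring

lemma mem_graph_iff {n : ℕ} {h : History n} {e : Sym2 (Fin n)} :
    e ∈ h.graph ↔ ∃ p ∈ h, s(p.1, p.2) = e := by
  simp [History.graph]

/-- If the graph of a history contains a copy of a graph with a subgraph of minimum degree at
least `d`, then some vertex has at least `d` hits. -/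
lemma exists_le_hits_of_containsCopy {V : Type*} [Fintype V] {G : SimpleGraph V} {d n : ℕ}
    {G' : G.Subgraph} (hne : G'.verts.Nonempty)
    (hdeg : ∀ v ∈ G'.verts, d ≤ (G'.neighborSet v).ncard) {h : History n}
    (hc : h.graph ∈ containsCopy G n) :
    ∃ x, d ≤ hits (2 ^ Fintype.card V ^ 2) h x := by
  classical
  obtain ⟨f⟩ := hc
  have hadj : ∀ {a b}, G.Adj a b → s(f a, f b) ∈ h.graph := fun hab =>
    ((SimpleGraph.fromEdgeSet_adj _).1 (f.toHom.map_adj hab)).1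
  set I : Finset (Fin n) := G'.verts.toFinset.image f with hI
  -- the arcs of the copy, without repetitions so that their number is bounded
  set L : List (Fin n × Fin n) := h.dedup.filter fun p => p.1 ∈ I ∧ p.2 ∈ I with hL
  have hsub : L.Sublist h := List.filter_sublist.trans (List.dedup_sublist h)
  have hnd : L.Nodup := (List.nodup_dedup h).filter _
  have hmem : ∀ p, p ∈ L ↔ p ∈ h ∧ p.1 ∈ I ∧ p.2 ∈ I := fun p => by simp [hL]
  have hlen : L.length ≤ Fintype.card V ^ 2 := by
    rw [← List.toFinset_card_of_nodup hnd]
    have h1 : L.toFinset ⊆ I ×ˢ I := fun p hp => by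
      have := (hmem p).1 (List.mem_toFinset.1 hp)
      exact Finset.mem_product.2 this.2
    have h2 : I.card ≤ Fintype.card V := Finset.card_image_le.trans (Finset.card_le_univ _)
    calc _ ≤ (I ×ˢ I).card := Finset.card_le_card h1
      _ = I.card * I.card := Finset.card_product _ _
      _ ≤ Fintype.card V * Fintype.card V := Nat.mul_le_mul h2 h2
      _ = _ := (sq _).symm
  obtain ⟨a, ha⟩ := hne
  have hpow : 2 ^ L.length ≤ 2 ^ Fintype.card V ^ 2 := Nat.pow_le_pow_right (by norm_num) hlen
  obtain ⟨x, hx, hdx⟩ := exists_degree_le_hits L hpow (f a)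
  -- a vertex from which `f a` can be reached along arcs of the copy lies in the copy
  have hxI : x ∈ I := by
    have key : ∀ (M : ℕ) (y : Fin n), y ∈ outBall L M x → y ∈ I → x ∈ I := by
      intro M
      induction M with
      | zero =>
        intro y hy hyI
        have : y = x := by simpa [outBall] using hy
        exact this ▸ hyI
      | succ M ih =>
        intro y hy hyI
        obtain ⟨z, hz, rfl | hzy⟩ := mem_outBall_succ.1 hy
        · exact ih _ hz hyI
        · exact ih z hz ((hmem _).1 hzy).2.1
    exact key _ _ hx (by rw [hI]; exact Finset.mem_image_of_mem _ (by simpa using ha))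
  obtain ⟨v, hv, rfl⟩ := Finset.mem_image.1 hxI
  rw [Set.mem_toFinset] at hv
  refine ⟨f v, le_trans ?_ (hdx.trans (hits_mono hsub _ _))⟩
  refine (hdeg v hv).trans ?_
  rw [Set.ncard_eq_toFinset_card', List.countP_eq_length_filter,
    ← List.toFinset_card_of_nodup (hnd.filter _)]
  refine (Finset.card_image_of_injective _ f.injective).symm.le.trans
    (le_trans (Finset.card_le_card (t := Finset.image (fun p => if p.1 = f v then p.2 else p.1)
      (L.filter fun p => p.1 = f v ∨ p.2 = f v).toFinset) ?_) Finset.card_image_le)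
  intro y hy
  obtain ⟨w, hw, rfl⟩ := Finset.mem_image.1 hy
  have hvw : G'.Adj v w := by simpa using hw
  have hwI : f w ∈ I := Finset.mem_image_of_mem _ (by simpa using hvw.snd_mem)
  have hne : f w ≠ f v := fun e => hvw.ne (f.injective e).symm
  obtain ⟨p, hp, hpe⟩ := mem_graph_iff.1 (hadj hvw.adj_sub)
  refine Finset.mem_image.2 ⟨p, ?_, ?_⟩ <;>
    rcases Sym2.eq_iff.1 hpe with ⟨h1, h2⟩ | ⟨h1, h2⟩ <;>
    simp [hmem, hp, h1, h2, hwI, hxI, hne]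

/-- Within `t` rounds no strategy creates a copy of a graph that is not `(d - 1)`-degenerate with
probability larger than a constant times `t ^ d / n ^ (d - 1)`. -/
lemma prob_containsCopy_le {V : Type*} [Fintype V] {G : SimpleGraph V} {d : ℕ}
    {G' : G.Subgraph} (hne : G'.verts.Nonempty)
    (hdeg : ∀ v ∈ G'.verts, d ≤ (G'.neighborSet v).ncard) {n : ℕ} [NeZero n] (S : Strategy n)
    (t : ℕ) :
    prob S t (containsCopy G n) ≤
      n * ((t : ℝ≥0∞) * ((d ^ 2 ^ Fintype.card V ^ 2 : ℕ) / n)) ^ d := by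
  set M := 2 ^ Fintype.card V ^ 2
  rw [prob, graphLaw, PMF.toOuterMeasure_map_apply]
  have hsub : History.graph ⁻¹' containsCopy G n ⊆
      ⋃ x : Fin n, {h | d ≤ cappedHits M (d ^ M) h x} := by
    intro h hh
    obtain ⟨x, hx⟩ := exists_le_hits_of_containsCopy hne hdeg hh
    by_contra hcon
    simp only [Set.mem_iUnion, Set.mem_ofPred_eq, not_exists, not_le] at hcon
    exact absurd (hits_eq_cappedHits hcon x ▸ hcon x) (not_lt.2 hx)
  refine (MeasureTheory.measure_mono hsub).trans
    ((MeasureTheory.measure_iUnion_le _).trans ?_)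
  rw [tsum_fintype]
  calc _ ≤ ∑ _x : Fin n, ((t : ℝ≥0∞) * ((d ^ M : ℕ) / n)) ^ d := by
        refine Finset.sum_le_sum fun x _ => toOuterMeasure_counter_le S
          (D := fun h => cappedBall M (d ^ M) h x) rfl (fun h p => le_rfl) (fun h => ?_) t d
        rw [cappedBall]
        split_ifs with hc
        · exact hc
        · simp
    _ = _ := by simp

/-! ### Expected waiting times under optimal play -/

open Classical in
/-- The least possible expectation, over the choices of the player, of the number of the next `T`
rounds that start before the multigraph has the property `P`, if the present multigraph is `H`. -/
noncomputable def waitingTime {n : ℕ} (P : Set (Multigraph n)) : ℕ → Multigraph n → ℝ≥0∞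
  | 0, _ => 0
  | T + 1, H => if H ∈ P then 0 else
      1 + ∑ u, (n : ℝ≥0∞)⁻¹ * ⨅ v, waitingTime P T (s(u, v) ::ₘ H)

lemma waitingTime_of_mem {n : ℕ} {P : Set (Multigraph n)} {H : Multigraph n} (hH : H ∈ P) (T : ℕ) :
    waitingTime P T H = 0 := by
  cases T with
  | zero => rfl
  | succ T => rw [waitingTime, if_pos hH]

/-- The player can reach the property `P` from `H`, and from every multigraph containing `H`, in
expected time at most `c`. -/
def ReachableWithin {n : ℕ} (P : Set (Multigraph n)) (c : ℝ≥0∞) (H : Multigraph n) : Prop :=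
  ∀ T H', H ≤ H' → waitingTime P T H' ≤ c

/-- A strategy that attains the infima in the definition of `waitingTime`. -/
lemma exists_optimal_choice {n : ℕ} [NeZero n] (P : Set (Multigraph n)) :
    ∃ σ : ℕ → Multigraph n → Fin n → Fin n, ∀ T H u,
      waitingTime P T (s(u, σ T H u) ::ₘ H) = ⨅ v, waitingTime P T (s(u, v) ::ₘ H) := by
  choose σ hσ using fun (T : ℕ) (H : Multigraph n) (u : Fin n) =>
    exists_eq_ciInf_of_finite (f := fun v => waitingTime P T (s(u, v) ::ₘ H))
  exact ⟨σ, hσ⟩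

lemma tsum_historyLaw_succ_pure {n : ℕ} [NeZero n] (σ : History n → Fin n → Fin n) (t : ℕ)
    (F : History n → ℝ≥0∞) :
    ∑' h, historyLaw (fun h u => PMF.pure (σ h u)) (t + 1) h * F h =
      ∑' h, historyLaw (fun h u => PMF.pure (σ h u)) t h *
        ∑ u, (n : ℝ≥0∞)⁻¹ * F ((u, σ h u) :: h) := by
  set p := historyLaw (fun h u => PMF.pure (σ h u)) t
  have h1 : ∀ g, historyLaw (fun h u => PMF.pure (σ h u)) (t + 1) g =
      ∑' h, p h * ∑ u, (n : ℝ≥0∞)⁻¹ * if g = (u, σ h u) :: h then 1 else 0 := by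
    intro g
    rw [historyLaw, PMF.bind_apply]
    refine tsum_congr fun h => ?_
    rw [PMF.bind_apply, tsum_fintype]
    congr 1
    refine Finset.sum_congr rfl fun u _ => ?_
    rw [PMF.pure_map, PMF.pure_apply, PMF.uniformOfFintype_apply, Fintype.card_fin]
    congr
  simp_rw [h1, ← ENNReal.tsum_mul_right]
  rw [ENNReal.tsum_comm]
  refine tsum_congr fun h => ?_
  simp_rw [mul_assoc]
  rw [ENNReal.tsum_mul_left]
  congr 1
  simp_rw [Finset.sum_mul]
  rw [Summable.tsum_finsetSum fun _ _ => ENNReal.summable]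
  refine Finset.sum_congr rfl fun u _ => ?_
  simp_rw [mul_assoc]
  rw [ENNReal.tsum_mul_left]
  congr 1
  rw [tsum_eq_single ((u, σ h u) :: h)]
  · simp
  · intro g hg
    simp [hg]

/-- The optimal strategy for `T` rounds fails with probability at most `waitingTime P T 0 / T`,
by Markov's inequality. -/
lemma exists_strategy_mul_le {n : ℕ} [NeZero n] {P : Set (Multigraph n)}
    (hP : ∀ H H', H ≤ H' → H ∈ P → H' ∈ P) (T : ℕ) :
    ∃ S : Strategy n, T * (historyLaw S T).toOuterMeasure {h | h.graph ∉ P} ≤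
      waitingTime P T 0 := by
  obtain ⟨σ, hσ⟩ := exists_optimal_choice P
  set τ : History n → Fin n → Fin n := fun h u => σ (T - h.length - 1) h.graph u
  refine ⟨fun h u => PMF.pure (τ h u), ?_⟩
  set p := historyLaw fun h u => PMF.pure (τ h u) with hp
  set F : Set (History n) := {h | h.graph ∉ P}
  have hn : (n : ℝ≥0∞) ≠ 0 := by exact_mod_cast NeZero.ne n
  have hgraph : ∀ (u v : Fin n) (h : History n),
      History.graph ((u, v) :: h) = s(u, v) ::ₘ h.graph := fun u v h => rfl
  have hmono : ∀ (u v : Fin n) (h : History n), h ∉ F → (u, v) :: h ∉ F := by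
    intro u v h hh hF
    exact hF (hP _ _ (Multiset.le_cons_self _ _) (not_not.1 hh))
  have hdecr : ∀ s, (p (s + 1)).toOuterMeasure F ≤ (p s).toOuterMeasure F := by
    intro s
    rw [toOuterMeasure_eq_tsum_mul, toOuterMeasure_eq_tsum_mul, hp, tsum_historyLaw_succ_pure]
    refine ENNReal.tsum_le_tsum fun h => mul_le_mul_right ?_ _
    by_cases hh : h ∈ F
    · rw [Set.indicator_of_mem hh]
      calc _ ≤ ∑ _u : Fin n, (n : ℝ≥0∞)⁻¹ * 1 :=
            Finset.sum_le_sum fun u _ => mul_le_mul_right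
              (Set.indicator_le_self F 1 ((u, τ h u) :: h)) _
        _ = 1 := by simp [ENNReal.mul_inv_cancel hn (ENNReal.natCast_ne_top n)]
    · rw [Finset.sum_eq_zero fun u _ => by rw [Set.indicator_of_notMem (hmono u _ h hh), mul_zero]]
      exact zero_le
  have hlen : ∀ s h, p s h ≠ 0 → h.length = s := by
    intro s
    induction s with
    | zero =>
      intro h hh
      have : h ∈ (PMF.pure ([] : History n)).support := hh
      simp at this
      simp [this]
    | succ s ih =>
      intro h hh
      rw [hp, historyLaw, ← PMF.mem_support_iff, PMF.mem_support_bind_iff] at hh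
      obtain ⟨g, hg, hh⟩ := hh
      obtain ⟨u, -, hh⟩ := (PMF.mem_support_bind_iff _ _ _).1 hh
      rw [PMF.pure_map, PMF.support_pure, Set.mem_singleton_iff] at hh
      rw [hh, List.length_cons, ih g hg]
  -- the drift of the potential `s * ℙ[H_s ∉ P] + 𝔼[waitingTime P (T - s) H_s]` is not positive
  have key : ∀ s, s ≤ T → s * (p s).toOuterMeasure F +
      ∑' h, p s h * waitingTime P (T - s) h.graph ≤ waitingTime P T 0 := by
    intro s
    induction s with
    | zero =>
      intro _
      rw [Nat.cast_zero, zero_mul, zero_add, tsum_eq_single []]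
      · exact (mul_le_mul_left (PMF.coe_le_one _ _) _).trans (one_mul _).le
      · intro h hh
        have : p 0 h = 0 := by
          by_contra hc
          exact hh (List.length_eq_zero_iff.1 (hlen 0 h hc))
        rw [this, zero_mul]
    | succ s ih =>
      intro hs
      refine le_trans ?_ (ih (by omega))
      have h1 : (p s).toOuterMeasure F +
          ∑' h, p (s + 1) h * waitingTime P (T - (s + 1)) h.graph ≤
          ∑' h, p s h * waitingTime P (T - s) h.graph := by
        rw [toOuterMeasure_eq_tsum_mul, hp, tsum_historyLaw_succ_pure, ← ENNReal.tsum_add, ← hp]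
        refine ENNReal.tsum_le_tsum fun h => ?_
        rw [← mul_add]
        by_cases h0 : p s h = 0
        · rw [h0, zero_mul, zero_mul]
        refine mul_le_mul_right ?_ _
        have hT : T - s = T - (s + 1) + 1 := by omega
        have hT' : T - h.length - 1 = T - (s + 1) := by rw [hlen s h h0]; omega
        by_cases hh : h ∈ F
        · rw [Set.indicator_of_mem hh, hT, waitingTime, if_neg hh, Pi.one_apply]
          refine add_le_add le_rfl (Finset.sum_le_sum fun u _ => mul_le_mul_right ?_ _)
          rw [hgraph, ← hσ]
          simp only [τ, hT', le_refl]
        · rw [Set.indicator_of_notMem hh, zero_add, Finset.sum_eq_zero fun u _ => ?_]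
          · exact zero_le
          · rw [waitingTime_of_mem (not_not.1 (hmono u _ h hh)), mul_zero]
      calc _ ≤ ((s : ℝ≥0∞) + 1) * (p s).toOuterMeasure F +
            ∑' h, p (s + 1) h * waitingTime P (T - (s + 1)) h.graph := by
            rw [Nat.cast_succ]
            exact add_le_add (mul_le_mul_right (hdecr s) _) le_rfl
        _ = s * (p s).toOuterMeasure F + ((p s).toOuterMeasure F +
            ∑' h, p (s + 1) h * waitingTime P (T - (s + 1)) h.graph) := by ring
        _ ≤ _ := add_le_add le_rfl h1
  exact le_self_add.trans (key T le_rfl)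

lemma ReachableWithin.of_mem {n : ℕ} {P : Set (Multigraph n)}
    (hP : ∀ H H', H ≤ H' → H ∈ P → H' ∈ P) {H : Multigraph n} (hH : H ∈ P) (c : ℝ≥0∞) :
    ReachableWithin P c H := fun T H' hle => by
  rw [waitingTime_of_mem (hP H H' hle hH)]
  exact zero_le

/-- If the player makes progress whenever the presented vertex lies in `A`, then this progress
takes expected time at most `n / #A`. -/
lemma ReachableWithin.step {n : ℕ} [NeZero n] {P : Set (Multigraph n)} {c x : ℝ≥0∞}
    {H : Multigraph n} (A : Finset (Fin n)) (hx : n ≤ A.card * x)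
    (hA : ∀ u ∈ A, ∃ v, ReachableWithin P c (s(u, v) ::ₘ H)) :
    ReachableWithin P (c + x) H := by
  intro T
  induction T with
  | zero => exact fun H' _ => zero_le
  | succ T ih =>
    intro H' hH
    have hn : (n : ℝ≥0∞) ≠ 0 := by exact_mod_cast NeZero.ne n
    have hn' : (n : ℝ≥0∞) ≠ ⊤ := ENNReal.natCast_ne_top n
    rw [waitingTime]
    split_ifs with hP
    · exact zero_le
    have h1 : ∀ u, ⨅ v, waitingTime P T (s(u, v) ::ₘ H') ≤ c + if u ∈ A then 0 else x := by
      intro u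
      split_ifs with hu
      · obtain ⟨v, hv⟩ := hA u hu
        rw [add_zero]
        exact (iInf_le _ v).trans (hv T _ (Multiset.cons_le_cons _ hH))
      · exact (iInf_le _ 0).trans (ih _ (hH.trans (Multiset.le_cons_self _ _)))
    have hcompl : (A.card : ℝ≥0∞) + Aᶜ.card = n := by
      have := A.card_add_card_compl
      rw [Fintype.card_fin] at this
      exact_mod_cast this
    have h2 : (∑ u, (c + if u ∈ A then 0 else x)) = n * c + Aᶜ.card * x := by
      rw [Finset.sum_add_distrib, Finset.sum_const, Finset.card_univ, Fintype.card_fin,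
        nsmul_eq_mul]
      congr 1
      have : ∀ u, (if u ∈ A then 0 else x) = if u ∈ Aᶜ then x else 0 := fun u => by
        by_cases hu : u ∈ A <;> simp [hu]
      simp_rw [this]
      rw [Finset.sum_ite_mem, Finset.univ_inter, Finset.sum_const, nsmul_eq_mul]
    calc _ ≤ 1 + ∑ u, (n : ℝ≥0∞)⁻¹ * (c + if u ∈ A then 0 else x) :=
          add_le_add le_rfl (Finset.sum_le_sum fun u _ => mul_le_mul_right (h1 u) _)
      _ = (n : ℝ≥0∞)⁻¹ * (n + (n * c + Aᶜ.card * x)) := by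
          rw [← Finset.mul_sum, h2, mul_add _ (n : ℝ≥0∞), ENNReal.inv_mul_cancel hn hn']
      _ ≤ (n : ℝ≥0∞)⁻¹ * (A.card * x + (n * c + Aᶜ.card * x)) := by gcongr
      _ = (n : ℝ≥0∞)⁻¹ * (n * (c + x)) := by
          rw [mul_add (n : ℝ≥0∞), ← hcompl]
          ring
      _ = c + x := by rw [← mul_assoc, ENNReal.inv_mul_cancel hn hn', one_mul]

/-- The round in which a vertex of a pool `A` is presented lets the player join it to `w`. If the
pool stays of size at least `a` throughout, then `b` distinct vertices of it can be joined to `w`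
in expected time `b n / a`; here `x` stands for `n / a`. -/
lemma ReachableWithin.collect {n : ℕ} [NeZero n] {P : Set (Multigraph n)} {c x : ℝ≥0∞} {a : ℕ}
    (hx : n ≤ a * x) (w : Fin n) (A₀ : Finset (Fin n)) {s : ℕ} {H₀ : Multigraph n}
    (hs : ∀ H, H₀ ≤ H → ∀ B ⊆ A₀, B.card = s → (∀ u ∈ B, s(u, w) ∈ H) → ReachableWithin P c H)
    (b : ℕ) {H : Multigraph n} (hH : H₀ ≤ H) {A B : Finset (Fin n)} (hA : A ⊆ A₀) (hB : B ⊆ A₀)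
    (hAB : Disjoint A B) (hBw : ∀ u ∈ B, s(u, w) ∈ H) (hbB : b + B.card = s)
    (hab : a + b ≤ A.card + 1) : ReachableWithin P (c + b * x) H := by
  induction b generalizing H A B with
  | zero =>
    rw [Nat.cast_zero, zero_mul, add_zero]
    exact hs H hH B hB (by omega) hBw
  | succ b ih =>
    have e : c + ((b + 1 : ℕ) : ℝ≥0∞) * x = c + b * x + x := by push_cast; ring
    rw [e]
    refine ReachableWithin.step A (hx.trans ?_) fun u hu => ⟨w, ?_⟩
    · have : a ≤ A.card := by omega
      gcongr
    · have huB : u ∉ B := Finset.disjoint_left.1 hAB hu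
      refine ih (hH.trans (Multiset.le_cons_self _ _)) (A := A.erase u) (B := insert u B)
        ((Finset.erase_subset _ _).trans hA) (Finset.insert_subset (hA hu) hB) ?_ ?_ ?_ ?_
      · rw [Finset.disjoint_insert_right]
        exact ⟨Finset.notMem_erase _ _, hAB.mono_left (Finset.erase_subset _ _)⟩
      · intro y hy
        rcases Finset.mem_insert.1 hy with rfl | hy
        · exact Multiset.mem_cons_self _ _
        · exact Multiset.mem_cons_of_mem (hBw y hy)
      · rw [Finset.card_insert_of_notMem huB]
        omega
      · rw [Finset.card_erase_of_mem hu]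
        omega

/-- A vertex outside a small set `U` joined to `d` given vertices can be created in expected time
`2 d n / m` if `m ^ d ≤ n` and `m` is large compared with `U`. To this end, `m ^ (d - i)` vertices
joined to the first `i` given vertices are collected for `i = 1, …, d`, each stage taking time
`2 n / m`; for `i = 0` the pool is the complement of `U`, whence the correction by `N`. -/
lemma ReachableWithin.extend {n : ℕ} [NeZero n] {P : Set (Multigraph n)} {C : ℝ≥0∞} {m d N : ℕ}
    (hmd : m ^ d ≤ n) (hm : 2 * N + 2 ≤ m) (hd : 1 ≤ d) (U : Finset (Fin n)) (hU : U.card ≤ N)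
    (w : ℕ → Fin n) {H₀ : Multigraph n}
    (hC : ∀ H, H₀ ≤ H → ∀ x, x ∉ U → (∀ j < d, s(x, w j) ∈ H) → ReachableWithin P C H) :
    ReachableWithin P (C + d * (2 * n / m)) H₀ := by
  have hm0 : (m : ℝ≥0∞) ≠ 0 := by
    have : m ≠ 0 := by omega
    exact_mod_cast this
  have hmt : (m : ℝ≥0∞) ≠ ⊤ := ENNReal.natCast_ne_top m
  -- the pool `A` of vertices joined to the first `i` targets, with `k = d - i` targets remaining
  have key : ∀ k i, i + k = d → ∀ H, H₀ ≤ H → ∀ A : Finset (Fin n), Disjoint A U →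
      m ^ k ≤ A.card + (if i = 0 then N else 0) → (∀ u ∈ A, ∀ j < i, s(u, w j) ∈ H) →
      ReachableWithin P (C + k * (2 * n / m)) H := by
    intro k
    induction k with
    | zero =>
      intro i hi H hH A hAU hcard hA
      rw [if_neg (by omega), pow_zero, add_zero] at hcard
      obtain ⟨x, hx⟩ := Finset.card_pos.1 hcard
      rw [Nat.cast_zero, zero_mul, add_zero]
      exact hC H hH x (Finset.disjoint_left.1 hAU hx) fun j hj => hA x hx j (by omega)
    | succ k ih =>
      intro i hi H hH A hAU hcard hA
      set x : ℝ≥0∞ := 2 * n / (m ^ (k + 1) : ℕ) with hxdef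
      have hpow : ((m ^ k : ℕ) : ℝ≥0∞) * x = 2 * n / m := by
        rw [hxdef, div_eq_mul_inv, div_eq_mul_inv, Nat.cast_pow, Nat.cast_pow, pow_succ,
          ENNReal.mul_inv (Or.inr hmt) (Or.inr hm0)]
        calc _ = 2 * (n : ℝ≥0∞) * ((m : ℝ≥0∞))⁻¹ * ((m : ℝ≥0∞) ^ k * ((m : ℝ≥0∞) ^ k)⁻¹) := by
              ring
          _ = _ := by
              rw [ENNReal.mul_inv_cancel (pow_ne_zero _ hm0) (ENNReal.pow_ne_top hmt), mul_one]
      have e : C + ((k + 1 : ℕ) : ℝ≥0∞) * (2 * n / m) =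
          C + k * (2 * n / m) + ((m ^ k : ℕ) : ℝ≥0∞) * x := by
        rw [hpow]; push_cast; ring
      rw [e]
      have hmk : 0 < m ^ k := Nat.pow_pos (by omega)
      have hps : m ^ (k + 1) = m ^ k * m := pow_succ m k
      -- the part of the pool that is always available has at least `m ^ (k + 1) / 2` elements
      obtain ⟨a, ha⟩ : ∃ a, a + m ^ k = A.card + 1 := ⟨A.card + 1 - m ^ k, by
        have : m ^ k ≤ A.card := by
          have : m ^ k * (2 * N + 2) ≤ m ^ k * m := Nat.mul_le_mul_left _ hm
          split_ifs at hcard <;> nlinarith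
        omega⟩
      have ha2 : m ^ (k + 1) ≤ 2 * a := by
        have : m ^ k * (2 * N + 2) ≤ m ^ k * m := Nat.mul_le_mul_left _ hm
        split_ifs at hcard <;> nlinarith
      have hxa : (n : ℝ≥0∞) ≤ a * x := by
        have h0 : ((m ^ (k + 1) : ℕ) : ℝ≥0∞) ≠ 0 := by
          have : m ^ (k + 1) ≠ 0 := pow_ne_zero _ (by omega)
          exact_mod_cast this
        calc (n : ℝ≥0∞) = n * (((m ^ (k + 1) : ℕ) : ℝ≥0∞) * ((m ^ (k + 1) : ℕ) : ℝ≥0∞)⁻¹) := by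
              rw [ENNReal.mul_inv_cancel h0 (ENNReal.natCast_ne_top _), mul_one]
          _ ≤ n * (((2 * a : ℕ) : ℝ≥0∞) * ((m ^ (k + 1) : ℕ) : ℝ≥0∞)⁻¹) := by gcongr
          _ = a * x := by rw [hxdef, div_eq_mul_inv]; push_cast; ring
      refine ReachableWithin.collect hxa (w i) A (H₀ := H) (s := m ^ k) ?_ (m ^ k) le_rfl
        (subset_refl A) (Finset.empty_subset A) (Finset.disjoint_empty_right A) (by simp) (by simp)
        ha.le
      intro H' hH' B hBA hBcard hB
      refine ih (i + 1) (by omega) H' (hH.trans hH') B (hAU.mono_left hBA) (by simp [hBcard]) ?_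
      intro u hu j hj
      rcases Nat.lt_succ_iff_lt_or_eq.1 hj with hj | rfl
      · exact Multiset.mem_of_le hH' (hA u (hBA hu) j hj)
      · exact hB u hu
  refine key d 0 (by omega) H₀ le_rfl Uᶜ disjoint_compl_left ?_ (by simp)
  have := U.card_add_card_compl
  rw [Fintype.card_fin] at this
  simp only [if_true]
  omega

/-! ### The order of the optimal time -/

lemma containsCopy_mono {V : Type*} (G : SimpleGraph V) (n : ℕ) (H H' : Multigraph n)
    (hle : H ≤ H') (hH : H ∈ containsCopy G n) : H' ∈ containsCopy G n :=
  SimpleGraph.IsContained.trans hH (SimpleGraph.IsContained.of_le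
    (SimpleGraph.fromEdgeSet_mono fun _ he => Multiset.mem_of_le hle he))

/-- A copy of a `d`-degenerate graph is built vertex by vertex, in an order in which each vertex has
at most `d` earlier neighbours. -/
lemma reachableWithin_containsCopy {V : Type*} [Fintype V] {G : SimpleGraph V} {d : ℕ}
    (hd : 1 ≤ d) (hG : IsDegenerate G d) {n m : ℕ} [NeZero n] (hmd : m ^ d ≤ n)
    (hm : 2 * Fintype.card V + 2 ≤ m) :
    ReachableWithin (containsCopy G n) (Fintype.card V * (d * (2 * n / m))) 0 := by
  classical
  set P := containsCopy G n
  have key : ∀ (k : ℕ) (W : Finset V), W.card = k → ∀ (C : ℝ≥0∞) (H₀ : Multigraph n),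
      (∀ H, H₀ ≤ H → ∀ f : V → Fin n, Set.InjOn f W →
        (∀ a ∈ W, ∀ b ∈ W, G.Adj a b → s(f a, f b) ∈ H) → ReachableWithin P C H) →
      ReachableWithin P (C + k * (d * (2 * n / m))) H₀ := by
    intro k
    induction k with
    | zero =>
      intro W hW C H₀ hC
      rw [Finset.card_eq_zero] at hW
      subst hW
      rw [Nat.cast_zero, zero_mul, add_zero]
      exact hC H₀ le_rfl (fun _ => 0) (by simp) (by simp)
    | succ k ih =>
      intro W hW C H₀ hC
      -- the vertex to be built last among those of `W`
      obtain ⟨v, hv, hdeg⟩ := hG ((⊤ : G.Subgraph).induce W) (by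
        simpa using Finset.card_pos.1 (by omega : 0 < W.card))
      have hvW : v ∈ W := by simpa using hv
      set S := W.filter (G.Adj v) with hS
      have hScard : S.card ≤ d := by
        have : ((⊤ : G.Subgraph).induce W).neighborSet v = (S : Set V) := by
          ext w
          simp [hS, hvW]
        rwa [this, Set.ncard_coe_finset] at hdeg
      have e : C + ((k + 1 : ℕ) : ℝ≥0∞) * (d * (2 * n / m)) =
          C + d * (2 * n / m) + k * (d * (2 * n / m)) := by push_cast; ring
      rw [e]
      refine ih (W.erase v) (by rw [Finset.card_erase_of_mem hvW]; omega) _ H₀ ?_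
      intro H hH f hf hfH
      -- an enumeration of the images of the earlier neighbours, padded to length `d`
      set c : ℕ → Fin n := fun j => (S.toList.map f).getD j 0 with hc
      have hcS : ∀ w ∈ S, ∃ j < d, c j = f w := by
        intro w hw
        obtain ⟨j, hj, hjw⟩ := List.getElem_of_mem (Finset.mem_toList.2 hw)
        refine ⟨j, (by simpa using hj : j < S.card).trans_le hScard, ?_⟩
        rw [hc]
        simp only
        rw [List.getD_eq_getElem _ _ (by simpa using hj), List.getElem_map, hjw]
      refine ReachableWithin.extend hmd hm hd ((W.erase v).image f)
        (Finset.card_image_le.trans (Finset.card_le_univ _)) c ?_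
      intro H' hH' x hx hxH
      have hne : ∀ a ∈ W, a ≠ v → f a ≠ x := fun a ha hav hax =>
        hx (Finset.mem_image.2 ⟨a, Finset.mem_erase.2 ⟨hav, ha⟩, hax⟩)
      have hnew : ∀ b ∈ W, G.Adj v b → s(x, f b) ∈ H' := by
        intro b hb hvb
        obtain ⟨j, hj, hjb⟩ := hcS b (Finset.mem_filter.2 ⟨hb, hvb⟩)
        exact hjb ▸ hxH j hj
      refine hC H' (hH.trans hH') (Function.update f v x) ?_ ?_
      · intro a ha b hb hab
        by_cases hav : a = v <;> by_cases hbv : b = v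
        · rw [hav, hbv]
        · subst hav
          rw [Function.update_self, Function.update_of_ne hbv] at hab
          exact absurd hab.symm (hne b hb hbv)
        · subst hbv
          rw [Function.update_self, Function.update_of_ne hav] at hab
          exact absurd hab (hne a ha hav)
        · rw [Function.update_of_ne hav, Function.update_of_ne hbv] at hab
          exact hf (by simp [hav]; exact ha) (by simp [hbv]; exact hb) hab
      · intro a ha b hb hab
        by_cases hav : a = v
        · subst hav
          rw [Function.update_self, Function.update_of_ne hab.ne']
          exact hnew b hb hab
        · by_cases hbv : b = v
          · subst hbv
            rw [Function.update_self, Function.update_of_ne hav, Sym2.eq_swap]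
            exact hnew a ha hab.symm
          · rw [Function.update_of_ne hav, Function.update_of_ne hbv]
            exact Multiset.mem_of_le hH' (hfH a (Finset.mem_erase.2 ⟨hav, ha⟩) b
              (Finset.mem_erase.2 ⟨hbv, hb⟩) hab)
  have := key _ Finset.univ rfl 0 0 ?_
  · rwa [zero_add, Finset.card_univ] at this
  intro H _ f hf hfH
  have hinj : Function.Injective f := fun a b hab => hf (by simp) (by simp) hab
  refine ReachableWithin.of_mem (containsCopy_mono G n) ?_ 0
  exact ⟨⟨⟨f, fun {a b} hab => (SimpleGraph.fromEdgeSet_adj _).2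
    ⟨hfH a (Finset.mem_univ _) b (Finset.mem_univ _) hab, fun e => hab.ne (hinj e)⟩⟩, hinj⟩⟩

/-- If `G` is not `(d - 1)`-degenerate, then the optimal time is at least of order
`n ^ ((d - 1) / d)`. -/
lemma exists_le_optimalTime {V : Type*} [Fintype V] {G : SimpleGraph V} {d : ℕ} (hd : 1 ≤ d)
    (hG : ¬ IsDegenerate G (d - 1)) {q : ℝ} (hq : 0 < q) :
    ∃ c : ℝ, 0 < c ∧ ∀ n : ℕ, [NeZero n] →
      ((⌈c * (n : ℝ) ^ (((d : ℝ) - 1) / d)⌉₊ : ℕ) : ℕ∞) ≤ optimalTime (containsCopy G n) q := by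
  simp only [IsDegenerate, not_forall, not_exists, not_and, not_le] at hG
  obtain ⟨G', hne, hdeg⟩ := hG
  have hdeg' : ∀ v ∈ G'.verts, d ≤ (G'.neighborSet v).ncard := fun v hv => by
    have := hdeg v hv
    omega
  set K : ℕ := d ^ 2 ^ Fintype.card V ^ 2 with hK
  have hKpos : (0 : ℝ) < K := by
    have : 0 < K := Nat.pow_pos hd
    exact_mod_cast this
  have hd0 : (d : ℝ) ≠ 0 := by
    have : d ≠ 0 := by omega
    exact_mod_cast this
  refine ⟨q ^ ((d : ℝ)⁻¹) / K, by positivity, fun n _ => ?_⟩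
  have hn : (0 : ℝ) < n := by exact_mod_cast NeZero.pos n
  refine le_iInf fun S => le_iInf fun t => le_iInf fun ht => ?_
  rw [Nat.cast_le, Nat.ceil_le]
  have h1 := ht.trans (prob_containsCopy_le hne hdeg' S t)
  rw [← hK] at h1
  have h2 : (n : ℝ≥0∞) * ((t : ℝ≥0∞) * ((K : ℕ) / n)) ^ d =
      ENNReal.ofReal (n * (t * (K / n)) ^ d) := by
    rw [ENNReal.ofReal_mul hn.le, ENNReal.ofReal_pow (by positivity),
      ENNReal.ofReal_mul (by positivity), ENNReal.ofReal_div_of_pos hn]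
    simp only [ENNReal.ofReal_natCast]
  rw [h2, ENNReal.ofReal_le_ofReal_iff (by positivity)] at h1
  refine (pow_le_pow_iff_left₀ (by positivity) (by positivity) (show d ≠ 0 by omega)).1 ?_
  have h3 : ((n : ℝ) ^ (((d : ℝ) - 1) / d)) ^ d = n ^ (d - 1) := by
    rw [← Real.rpow_natCast, ← Real.rpow_mul hn.le, div_mul_cancel₀ _ hd0, ← Real.rpow_natCast,
      Nat.cast_sub hd, Nat.cast_one]
  have h4 : (q ^ ((d : ℝ)⁻¹)) ^ d = q := by
    rw [← Real.rpow_natCast, ← Real.rpow_mul hq.le, inv_mul_cancel₀ hd0, Real.rpow_one]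
  rw [mul_pow, div_pow, h3, h4]
  have hnd : (n : ℝ) ^ d = n ^ (d - 1) * n := by
    rw [← pow_succ, Nat.sub_add_cancel hd]
  have h5 : (n : ℝ) * (t * (K / n)) ^ d = t ^ d * K ^ d / n ^ (d - 1) := by
    rw [mul_pow, div_pow, hnd]
    field_simp
  rw [h5, le_div_iff₀ (by positivity)] at h1
  rw [div_mul_eq_mul_div, div_le_iff₀ (by positivity)]
  exact h1

/-- If `G` is `d`-degenerate, then the optimal time is at most of order `n ^ ((d - 1) / d)`. -/
lemma exists_optimalTime_le {V : Type*} [Fintype V] {G : SimpleGraph V} {d : ℕ} (hd : 1 ≤ d)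
    (hG : IsDegenerate G d) {q : ℝ} (hq0 : 0 < q) (hq : q < 1) :
    ∃ C : ℝ, 0 < C ∧ ∀ᶠ n : ℕ in atTop, ∀ [NeZero n],
      optimalTime (containsCopy G n) q ≤
        ((⌈C * (n : ℝ) ^ (((d : ℝ) - 1) / d)⌉₊ : ℕ) : ℕ∞) := by
  have hd0 : (0 : ℝ) < d := by exact_mod_cast hd
  have hq' : 0 < 1 - q := by linarith
  refine ⟨(4 * Fintype.card V * d + 1) / (1 - q), by positivity, ?_⟩
  have hlim : Tendsto (fun n : ℕ => (n : ℝ) ^ ((d : ℝ)⁻¹)) atTop atTop :=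
    (tendsto_rpow_atTop (by positivity)).comp tendsto_natCast_atTop_atTop
  filter_upwards [hlim.eventually_ge_atTop ((2 * Fintype.card V + 2 : ℕ) : ℝ)] with n hroot _
  have hn : (0 : ℝ) < n := by exact_mod_cast NeZero.pos n
  set r : ℝ := (n : ℝ) ^ ((d : ℝ)⁻¹) with hr
  set m : ℕ := ⌊r⌋₊ with hm
  have hr0 : 0 < r := Real.rpow_pos_of_pos hn _
  have hmV : 2 * Fintype.card V + 2 ≤ m := Nat.le_floor hroot
  have hrd : r ^ d = n := by
    rw [hr, ← Real.rpow_natCast, ← Real.rpow_mul hn.le, inv_mul_cancel₀ hd0.ne', Real.rpow_one]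
  have hmd : m ^ d ≤ n := by
    have : (m : ℝ) ^ d ≤ n := hrd ▸ pow_le_pow_left₀ (by positivity) (Nat.floor_le hr0.le) d
    exact_mod_cast this
  have hm0 : (0 : ℝ) < m := by
    have : 0 < m := by omega
    exact_mod_cast this
  have hrm : r ≤ 2 * m := by
    have h1 : r < m + 1 := Nat.lt_floor_add_one r
    have h2 : (1 : ℝ) ≤ m := by
      have : 1 ≤ m := by omega
      exact_mod_cast this
    linarith
  set y : ℝ := (n : ℝ) ^ (((d : ℝ) - 1) / d) with hy
  have hy0 : 0 < y := Real.rpow_pos_of_pos hn _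
  have hyr : y * r = n := by
    rw [hy, hr, ← Real.rpow_add hn]
    have : ((d : ℝ) - 1) / d + (d : ℝ)⁻¹ = 1 := by field_simp; ring
    rw [this, Real.rpow_one]
  set T : ℕ := ⌈(4 * Fintype.card V * d + 1) / (1 - q) * y⌉₊ with hT
  have hTle : (4 * Fintype.card V * d + 1) / (1 - q) * y ≤ T := Nat.le_ceil _
  have hT0 : (0 : ℝ) < T := lt_of_lt_of_le (by positivity) hTle
  obtain ⟨S, hS⟩ := exists_strategy_mul_le (containsCopy_mono G n) T
  have hfail := hS.trans (reachableWithin_containsCopy hd hG hmd hmV T 0 le_rfl)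
  set fail := (historyLaw S T).toOuterMeasure {h | h.graph ∉ containsCopy G n}
  have hreal : (Fintype.card V : ℝ≥0∞) * (d * (2 * n / m)) =
      ENNReal.ofReal (Fintype.card V * (d * (2 * n / m))) := by
    rw [ENNReal.ofReal_mul (by positivity), ENNReal.ofReal_mul (by positivity),
      ENNReal.ofReal_div_of_pos hm0, ENNReal.ofReal_mul (by positivity)]
    simp only [ENNReal.ofReal_natCast, ENNReal.ofReal_ofNat]
  have hbound : (Fintype.card V : ℝ) * (d * (2 * n / m)) ≤ T * (1 - q) := by
    have h1 : 2 * (n : ℝ) / m ≤ 4 * y := by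
      rw [div_le_iff₀ hm0, ← hyr]
      nlinarith
    have h2 : (4 * Fintype.card V * d + 1) * y ≤ T * (1 - q) := by
      rw [div_mul_eq_mul_div, div_le_iff₀ hq'] at hTle
      exact hTle
    have h3 : (Fintype.card V : ℝ) * (d * (2 * n / m)) ≤ Fintype.card V * (d * (4 * y)) := by
      gcongr
    nlinarith
  have hfail' : fail ≤ ENNReal.ofReal (1 - q) := by
    have hT0' : (T : ℝ≥0∞) ≠ 0 := by
      have : T ≠ 0 := by
        rintro h
        rw [h] at hT0
        simp at hT0
      exact_mod_cast this
    refine (ENNReal.mul_le_mul_iff_right hT0' (ENNReal.natCast_ne_top T)).1 ?_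
    rw [hreal] at hfail
    refine hfail.trans ((ENNReal.ofReal_le_ofReal hbound).trans ?_)
    rw [ENNReal.ofReal_mul hT0.le, ENNReal.ofReal_natCast]
  have hprob : ENNReal.ofReal q ≤ prob S T (containsCopy G n) := by
    have h1 : (1 : ℝ≥0∞) ≤ prob S T (containsCopy G n) + fail := by
      rw [prob, graphLaw, PMF.toOuterMeasure_map_apply]
      refine le_trans ?_ (MeasureTheory.measure_union_le _ _)
      rw [(PMF.toOuterMeasure_apply_eq_one_iff _ _).2]
      intro h _
      exact em (h.graph ∈ containsCopy G n)
    have h2 : ENNReal.ofReal q + ENNReal.ofReal (1 - q) = 1 := by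
      rw [← ENNReal.ofReal_add hq0.le hq'.le]
      simp
    rw [← h2] at h1
    exact (ENNReal.add_le_add_iff_right ENNReal.ofReal_ne_top).1 (h1.trans (by gcongr))
  exact (iInf_le _ S).trans (iInf₂_le T hprob)

lemma ennreal_log_ofReal_div {x L : ℝ} (hx : 0 < x) :
    ENNReal.log (ENNReal.ofReal x) / (L : EReal) = ((Real.log x / L : ℝ) : EReal) := by
  rw [ENNReal.log_pos_real' (by rwa [ENNReal.toReal_ofReal hx.le]), ENNReal.toReal_ofReal hx.le,
    EReal.coe_div]

lemma tendsto_log_const_mul_rpow_div {c : ℝ} (hc : 0 < c) (a : ℝ) :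
    Tendsto (fun n : ℕ => ((Real.log (c * ((n + 1 : ℕ) : ℝ) ^ a) /
      Real.log ((n + 1 : ℕ) : ℝ) : ℝ) : EReal)) atTop (𝓝 (a : EReal)) := by
  refine (continuous_coe_real_ereal.tendsto a).comp ?_
  have hlog : Tendsto (fun n : ℕ => Real.log ((n + 1 : ℕ) : ℝ)) atTop atTop :=
    Real.tendsto_log_atTop.comp (tendsto_natCast_atTop_atTop.comp (tendsto_add_atTop_nat 1))
  have h1 : Tendsto (fun n : ℕ => Real.log c / Real.log ((n + 1 : ℕ) : ℝ) + a) atTop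
      (𝓝 (0 + a)) := (tendsto_const_nhds.div_atTop hlog).add tendsto_const_nhds
  rw [zero_add] at h1
  refine h1.congr' ?_
  filter_upwards [hlog.eventually_gt_atTop 0] with n hn
  have hpos : (0 : ℝ) < ((n + 1 : ℕ) : ℝ) := by positivity
  rw [Real.log_mul hc.ne' (Real.rpow_pos_of_pos hpos a).ne', Real.log_rpow hpos, add_div,
    mul_div_cancel_right₀ _ hn.ne']

/-- The exponent does not depend on the success probability `q`. -/
lemma exponentAt_containsCopy {V : Type*} [Fintype V] {G : SimpleGraph V} {d : ℕ} (hd : 1 ≤ d)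
    (hG : IsDegenerate G d) (hG' : ¬ IsDegenerate G (d - 1)) {q : ℝ} (hq0 : 0 < q) (hq : q < 1) :
    exponentAt (containsCopy G) q = ((((d : ℝ) - 1) / (d : ℝ) : ℝ) : EReal) := by
  obtain ⟨c, hc, hlow⟩ := exists_le_optimalTime hd hG' hq0
  obtain ⟨C, hC, hupp⟩ := exists_optimalTime_le hd hG hq0 hq
  set a : ℝ := ((d : ℝ) - 1) / d with ha
  have ha0 : 0 ≤ a := by
    have : (1 : ℝ) ≤ d := by exact_mod_cast hd
    exact div_nonneg (by linarith) (by linarith)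
  refine Tendsto.limsup_eq (tendsto_of_tendsto_of_tendsto_of_le_of_le'
    (tendsto_log_const_mul_rpow_div hc a)
    (tendsto_log_const_mul_rpow_div (show 0 < C + 1 by linarith) a) ?_ ?_)
  · refine Eventually.of_forall fun n => ?_
    have hpos : (0 : ℝ) < ((n + 1 : ℕ) : ℝ) := by positivity
    have hL : (0 : EReal) ≤ (Real.log ((n + 1 : ℕ) : ℝ) : ℝ) :=
      EReal.coe_nonneg.2 (Real.log_natCast_nonneg _)
    rw [← ennreal_log_ofReal_div (by positivity)]
    refine EReal.div_le_div_right_of_nonneg hL (ENNReal.log_monotone ?_)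
    calc _ ≤ ((⌈c * ((n + 1 : ℕ) : ℝ) ^ a⌉₊ : ℕ) : ℝ≥0∞) := by
          rw [← ENNReal.ofReal_natCast]
          exact ENNReal.ofReal_le_ofReal (Nat.le_ceil _)
      _ = (((⌈c * ((n + 1 : ℕ) : ℝ) ^ a⌉₊ : ℕ) : ℕ∞) : ℝ≥0∞) := by simp
      _ ≤ _ := ENat.toENNReal_mono (hlow (n + 1))
  · filter_upwards [(tendsto_add_atTop_nat 1).eventually hupp] with n hn
    have hone : (1 : ℝ) ≤ ((n + 1 : ℕ) : ℝ) := by exact_mod_cast Nat.le_add_left 1 n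
    have hL : (0 : EReal) ≤ (Real.log ((n + 1 : ℕ) : ℝ) : ℝ) :=
      EReal.coe_nonneg.2 (Real.log_natCast_nonneg _)
    have hge : 1 ≤ ((n + 1 : ℕ) : ℝ) ^ a := Real.one_le_rpow hone ha0
    rw [← ennreal_log_ofReal_div (by positivity)]
    refine EReal.div_le_div_right_of_nonneg hL (ENNReal.log_monotone ?_)
    calc _ ≤ (((⌈C * ((n + 1 : ℕ) : ℝ) ^ a⌉₊ : ℕ) : ℕ∞) : ℝ≥0∞) := ENat.toENNReal_mono hn
      _ = ((⌈C * ((n + 1 : ℕ) : ℝ) ^ a⌉₊ : ℕ) : ℝ≥0∞) := by simp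
      _ ≤ _ := by
          rw [← ENNReal.ofReal_natCast]
          refine ENNReal.ofReal_le_ofReal ((Nat.ceil_lt_add_one (by positivity)).le.trans ?_)
          linarith

end SemiRandom

theorem mainTheorem2 {V : Type*} [Finite V] (G : SimpleGraph V) (d : ℕ) (hd : 1 ≤ d)
    (hG : SemiRandom.degeneracy G = d) :
    SemiRandom.HasThresholdExponent (SemiRandom.containsCopy G)
      ((((d : ℝ) - 1) / (d : ℝ) : ℝ) : EReal) := by
  have := Fintype.ofFinite V
  have hne : {d : ℕ | SemiRandom.IsDegenerate G d}.Nonempty := by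
    refine Set.nonempty_iff_ne_empty.2 fun he => ?_
    rw [SemiRandom.degeneracy, he, Nat.sInf_empty] at hG
    omega
  have hdeg : SemiRandom.IsDegenerate G d := hG ▸ Nat.sInf_mem hne
  have hdeg' : ¬ SemiRandom.IsDegenerate G (d - 1) := fun h => by
    have : SemiRandom.degeneracy G ≤ d - 1 := Nat.sInf_le h
    omega
  refine tendsto_const_nhds.congr' ?_
  filter_upwards [Ioo_mem_nhdsLT (zero_lt_one' ℝ)] with q hq
  exact (SemiRandom.exponentAt_containsCopy hd hdeg hdeg' hq.1 hq.2).symm
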